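/- Let $d\ge 1$, let $\alpha_1,\dots,\alpha_d>0$, and let $Q_d=\{-1,1\}^d$ with coordinatewise multiplication. For $\sigma$-finite measures $\nu,\rho$ on $\mathbb R^d$ let $\nu\circledast\rho$ be the measure $(\nu\circledast\rho)(B)=\int_{\mathbb R^d}\nu(T_{\mathbf x}^{-1}B)\,\rho(d\mathbf x)$, $B\subset\mathbb R^d$ Borel, where $T_{\mathbf x}=\mathrm{diag}(\mathbf x)$. Let $(\rho_v)_{v\in Q_d}$ be $\sigma$-finite Borel measures on $(0,\infty)^d$, and let $(\nu_v^{(i)})_{v\in Q_d}$, $i=1,2$, be $\sigma$-finite Borel measures on $[0,\infty)^d$ (all regarded as measures on $\mathbb R^d$). Let $K\subseteq\{1,\dots,d\}$ be a non-empty set such that $$\nu_v^{(i)}\bigl(\{\mathbf x:\ x_k=0\ \text{for each } k\in K\}\bigr)=0,\qquad i=1,2,\ v\in Q_d,$$ $$\int_{(0,\infty)^d}x_j^{\alpha_j}\,\rho_v(d\mathbf x)<\infty,\qquad v\in Q_d,\ j\in K,$$ $$\sup_{s>0}\,s^{\alpha_j}\,\nu_v^{(i)}\bigl(\{\mathbf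 x:\ x_j>s\}\bigr)<\infty,\qquad i=1,2,\ v\in Q_d,\ j\in K.$$ Suppose that $$\sum_{w\in Q_d}\nu_w^{(1)}\circledast\rho_{vw}=\sum_{w\in Q_d}\nu_w^{(2)}\circledast\rho_{vw}\qquad\text{for each } v\in Q_d.$$ Suppose moreover that for every $j\in K$ there are $v^{(j)}\in Q_d$ and an atom $\mathbf x^{(j)}=(x_1^{(j)},\dots,x_d^{(j)})\in(0,\infty)^d$ of $\rho_{v^{(j)}}$, with mass $w^{(j)}=\rho_{v^{(j)}}(\{\mathbf x^{(j)}\})>0$, such that $$w^{(j)}\bigl(x_j^{(j)}\bigr)^{\alpha_j}>\int_{(0,\infty)^d\setminus\{\mathbf x^{(j)}\}}x_j^{\alpha_j}\,\rho_{v^{(j)}}(d\mathbf x)+\sum_{v\ne v^{(j)}}\int_{(0,\infty)^d}x_j^{\alpha_j}\,\rho_v(d\mathbf x).$$ Then $\nu_v^{(1)}=\nu_v^{(2)}$ for each $v\in Q_d$. -/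

import Mathlib

open MeasureTheory
open scoped ENNReal

/-- The group `Q_d = {-1, 1}^d` with coordinatewise multiplication. -/
abbrev SignGroup (d : ℕ) : Type := Fin d → ℤˣ

/-- The open orthant `(0, ∞)^d`. -/
def openOrthant (d : ℕ) : Set (Fin d → ℝ) := {x | ∀ k, 0 < x k}

/-- The closed orthant `[0, ∞)^d`. -/
def closedOrthant (d : ℕ) : Set (Fin d → ℝ) := {x | ∀ k, 0 ≤ x k}

/-- The diagonal map `T_x = diag(x)` on `ℝ^d`. -/
def diagMap {d : ℕ} (x z : Fin d → ℝ) : Fin d → ℝ := fun k => x k * z k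

/-- The multiplicative convolution of `ν` and `ρ`: the measure
`B ↦ ∫ ν (T_x⁻¹ B) ρ(dx)` (see `mulConvolution_apply`). -/
noncomputable def mulConvolution {d : ℕ} (ν ρ : Measure (Fin d → ℝ)) : Measure (Fin d → ℝ) :=
  ρ.bind fun x => ν.map (diagMap x)

theorem measurable_diagMap_prod (d : ℕ) :
    Measurable fun p : (Fin d → ℝ) × (Fin d → ℝ) => diagMap p.1 p.2 := by
  unfold diagMap
  fun_prop

theorem measurable_diagMap {d : ℕ} (x : Fin d → ℝ) : Measurable (diagMap x) := by
  unfold diagMap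
  fun_prop

theorem mulConvolution_apply {d : ℕ} (ν ρ : Measure (Fin d → ℝ)) [SigmaFinite ν]
    {B : Set (Fin d → ℝ)} (hB : MeasurableSet B) :
    mulConvolution ν ρ B = ∫⁻ x, ν (diagMap x ⁻¹' B) ∂ρ := by
  have h : Measurable fun x : Fin d → ℝ => ν.map (diagMap x) := by
    refine Measure.measurable_of_measurable_coe _ fun s hs => ?_
    simp_rw [Measure.map_apply (measurable_diagMap _) hs]
    exact measurable_measure_prodMk_left (measurable_diagMap_prod d hs)
  rw [mulConvolution, Measure.bind_apply hB h.aemeasurable]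
  simp_rw [Measure.map_apply (measurable_diagMap _) hB]

/-! Fix `j ∈ K` and compare the two families on sets inside `{x | s < x j}`, with error weighted by
`s ^ α`. Dilation by `x` scales this error by `x j ^ α`, so in the system the dominant atom acts as
an invertible main term and the rest of `ρ` as a perturbation: an error `C` improves to `C * (m /
p)` with `m / p < 1` (`TailDominated.of_system`). The tail hypothesis supplies a finite initial
error, and iteration drives it to `0`. Hence the families agree on every `{x | s < x j}`, and these
sets cover almost everything. Two one-sided bounds replace a signed difference, since the measures
may be infinite. -/

/-- On every set `B ⊆ {x | s < x j}` with `s > 0`, the measure `μ` exceeds `ν` by at most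
`C * s ^ (-α)`. -/
def TailDominated {d : ℕ} (j : Fin d) (α : ℝ) (C : ℝ≥0∞) (μ ν : Measure (Fin d → ℝ)) : Prop :=
  ∀ s : ℝ, 0 < s → ∀ B : Set (Fin d → ℝ), MeasurableSet B → B ⊆ {x | s < x j} →
    ENNReal.ofReal (s ^ α) * μ B ≤ ENNReal.ofReal (s ^ α) * ν B + C

theorem measurable_measure_diagMap_preimage {d : ℕ} (μ : Measure (Fin d → ℝ)) [SFinite μ]
    {B : Set (Fin d → ℝ)} (hB : MeasurableSet B) :
    Measurable fun x : Fin d → ℝ => μ (diagMap x ⁻¹' B) :=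
  measurable_measure_prodMk_left (measurable_diagMap_prod d hB)

theorem TailDominated.of_tail {d : ℕ} {j : Fin d} {α : ℝ} (μ ν : Measure (Fin d → ℝ)) :
    TailDominated j α (⨆ (s : ℝ) (_ : 0 < s), ENNReal.ofReal (s ^ α) * μ {x | s < x j}) μ ν := by
  intro s hs B _ hBs
  refine le_add_left ?_
  calc ENNReal.ofReal (s ^ α) * μ B ≤ ENNReal.ofReal (s ^ α) * μ {x | s < x j} := by gcongr
    _ ≤ _ := le_iSup₂ (f := fun (s : ℝ) (_ : 0 < s) =>
      ENNReal.ofReal (s ^ α) * μ {x | s < x j}) s hs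

theorem TailDominated.mono {d : ℕ} {j : Fin d} {α : ℝ} {C C' : ℝ≥0∞} {μ ν : Measure (Fin d → ℝ)}
    (h : TailDominated j α C μ ν) (hC : C ≤ C') : TailDominated j α C' μ ν :=
  fun s hs B hB hBs => (h s hs B hB hBs).trans (by gcongr)

/-- Pulling `B` back by `diagMap x` changes the threshold `s` to `s / x j`, and `s ^ α = x j ^ α *
(s / x j) ^ α`; integrating the error gives the `α`-moment of `ρ`. -/
theorem TailDominated.lintegral_le {d : ℕ} {j : Fin d} {α : ℝ} {C : ℝ≥0∞}
    {μ ν ρ : Measure (Fin d → ℝ)} [SFinite μ] [SFinite ν]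
    (h : TailDominated j α C μ ν) (hρ : ∀ᵐ x ∂ρ, x ∈ openOrthant d)
    {s : ℝ} (hs : 0 < s) {B : Set (Fin d → ℝ)} (hB : MeasurableSet B)
    (hBs : B ⊆ {x | s < x j}) :
    ENNReal.ofReal (s ^ α) * ∫⁻ x, μ (diagMap x ⁻¹' B) ∂ρ ≤
      ENNReal.ofReal (s ^ α) * ∫⁻ x, ν (diagMap x ⁻¹' B) ∂ρ
        + C * ∫⁻ x, ENNReal.ofReal (x j ^ α) ∂ρ := by
  have hm : Measurable fun x : Fin d → ℝ => ENNReal.ofReal (x j ^ α) := by fun_prop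
  rw [← lintegral_const_mul _ (measurable_measure_diagMap_preimage μ hB),
    ← lintegral_const_mul _ (measurable_measure_diagMap_preimage ν hB),
    ← lintegral_const_mul _ hm, ← lintegral_add_right _ (hm.const_mul C)]
  refine lintegral_mono_ae ?_
  filter_upwards [hρ] with x hx
  have hy : 0 < x j := hx j
  have hsub : diagMap x ⁻¹' B ⊆ {z | s / x j < z j} := by
    intro z hz
    have : s < x j * z j := hBs hz
    rwa [Set.mem_ofPred_eq, div_lt_iff₀' hy]
  have key := h (s / x j) (div_pos hs hy) _ (measurable_diagMap x hB) hsub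
  have hsplit : ENNReal.ofReal (s ^ α) =
      ENNReal.ofReal (x j ^ α) * ENNReal.ofReal ((s / x j) ^ α) := by
    rw [← ENNReal.ofReal_mul (by positivity), ← Real.mul_rpow hy.le (div_pos hs hy).le,
      mul_div_cancel₀ _ hy.ne']
  calc _ = ENNReal.ofReal (x j ^ α) *
        (ENNReal.ofReal ((s / x j) ^ α) * μ (diagMap x ⁻¹' B)) := by rw [hsplit, mul_assoc]
    _ ≤ ENNReal.ofReal (x j ^ α) *
        (ENNReal.ofReal ((s / x j) ^ α) * ν (diagMap x ⁻¹' B) + C) := by gcongr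
    _ = _ := by rw [hsplit, mul_add, mul_assoc, mul_comm C]

/-- Isolating an atom `a` of `ρ u` in the system turns a bound `C` into `C * m / p`, where `m` is
the total `α`-moment away from the atom and `p` the moment carried by the atom. -/
theorem TailDominated.of_system {d : ℕ} {j : Fin d} {α : ℝ} {C C₀ m p : ℝ≥0∞}
    {ρ μ ν : SignGroup d → Measure (Fin d → ℝ)}
    [∀ w, SFinite (μ w)] [∀ w, SFinite (ν w)]
    (hρ : ∀ v, ∀ᵐ x ∂(ρ v), x ∈ openOrthant d)
    (h_system : ∀ v : SignGroup d, ∀ B : Set (Fin d → ℝ), MeasurableSet B →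
      ∑ w, ∫⁻ x, μ w (diagMap x ⁻¹' B) ∂(ρ (v * w)) =
        ∑ w, ∫⁻ x, ν w (diagMap x ⁻¹' B) ∂(ρ (v * w)))
    {u : SignGroup d} {a : Fin d → ℝ} (ha : a ∈ openOrthant d)
    (hm : ∫⁻ x in {a}ᶜ, ENNReal.ofReal (x j ^ α) ∂(ρ u)
      + ∑ v ∈ Finset.univ.erase u, ∫⁻ x, ENNReal.ofReal (x j ^ α) ∂(ρ v) = m)
    (hm_top : m ≠ ∞)
    (hp : ρ u {a} * ENNReal.ofReal (a j ^ α) = p) (hp0 : p ≠ 0) (hp_top : p ≠ ∞)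
    (hC₀ : C₀ ≠ ∞) (h₀ : ∀ w, TailDominated j α C₀ (μ w) 0)
    (h : ∀ w, TailDominated j α C (ν w) (μ w)) (w₀ : SignGroup d) :
    TailDominated j α (C * (m / p)) (μ w₀) (ν w₀) := by
  classical
  intro s hs B hB hBs
  -- The family `ρ` with the atom removed; its total `α`-moment is `m`.
  let σ : SignGroup d → Measure (Fin d → ℝ) := Function.update ρ u ((ρ u).restrict {a}ᶜ)
  have hσ : ∀ g, ∀ᵐ x ∂(σ g), x ∈ openOrthant d := by
    intro g
    rcases eq_or_ne g u with rfl | hg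
    · simpa only [σ, Function.update_self] using ae_restrict_of_ae (hρ g)
    · simpa only [σ, Function.update_of_ne hg] using hρ g
  have hσm : ∑ g, ∫⁻ x, ENNReal.ofReal (x j ^ α) ∂(σ g) = m := by
    rw [← hm, ← Finset.add_sum_erase _ _ (Finset.mem_univ u)]
    congr 1
    · simp only [σ, Function.update_self]
    · refine Finset.sum_congr rfl fun g hg => ?_
      simp only [σ, Function.update_of_ne (Finset.ne_of_mem_erase hg)]
  -- In the equation indexed by this `v`, `ρ u` is paired with index `w₀` only.
  set v : SignGroup d := u * w₀⁻¹ with hv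
  have hvw₀ : v * w₀ = u := by simp [hv]
  have hσm' : ∑ w, ∫⁻ x, ENNReal.ofReal (x j ^ α) ∂(σ (v * w)) = m := by
    rw [← hσm]
    exact Fintype.sum_equiv (Equiv.mulLeft v) _ _ fun w => rfl
  -- the dilated set whose preimage under `diagMap a` is `B`
  set A : Set (Fin d → ℝ) := diagMap a⁻¹ ⁻¹' B with hA
  have hA_meas : MeasurableSet A := measurable_diagMap _ hB
  have hA_pre : diagMap a ⁻¹' A = B := by
    ext z
    have : diagMap a⁻¹ (diagMap a z) = z := by
      funext k
      simp [diagMap, inv_mul_cancel_left₀ (ha k).ne']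
    simp [hA, this]
  have haj : 0 < a j := ha j
  have hA_sub : A ⊆ {x | a j * s < x j} := by
    intro z hz
    have : s < (a j)⁻¹ * z j := hBs hz
    rwa [Set.mem_ofPred_eq, ← lt_inv_mul_iff₀ haj]
  set t : ℝ := a j * s with ht
  have ht0 : 0 < t := mul_pos haj hs
  have hsplit : ∀ κ : SignGroup d → Measure (Fin d → ℝ),
      ∑ w, ∫⁻ x, κ w (diagMap x ⁻¹' A) ∂(ρ (v * w)) =
        ρ u {a} * κ w₀ B + ∑ w, ∫⁻ x, κ w (diagMap x ⁻¹' A) ∂(σ (v * w)) := by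
    intro κ
    rw [← Finset.add_sum_erase _ _ (Finset.mem_univ w₀),
      ← Finset.add_sum_erase (f := fun w => ∫⁻ x, κ w (diagMap x ⁻¹' A) ∂(σ (v * w))) _
        (Finset.mem_univ w₀), ← add_assoc]
    congr 1
    · rw [hvw₀]
      simp only [σ, Function.update_self]
      rw [← lintegral_add_compl _ (measurableSet_singleton a), lintegral_singleton, hA_pre,
        mul_comm]
    · refine Finset.sum_congr rfl fun w hw => ?_
      have hne : v * w ≠ u := fun hc =>
        Finset.ne_of_mem_erase hw (mul_left_cancel (hc.trans hvw₀.symm))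
      simp only [σ, Function.update_of_ne hne]
  set T := ENNReal.ofReal (t ^ α) with hT
  set R : (SignGroup d → Measure (Fin d → ℝ)) → ℝ≥0∞ := fun κ =>
    ∑ w, ∫⁻ x, κ w (diagMap x ⁻¹' A) ∂(σ (v * w)) with hR
  have hsys : T * (ρ u {a} * μ w₀ B) + T * R μ = T * (ρ u {a} * ν w₀ B) + T * R ν := by
    rw [← mul_add, ← mul_add, ← hsplit, ← hsplit, h_system v A hA_meas]
  have hRle : T * R ν ≤ T * R μ + C * m := by
    rw [hR, ← hσm', Finset.mul_sum, Finset.mul_sum, Finset.mul_sum, ← Finset.sum_add_distrib]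
    exact Finset.sum_le_sum fun w _ => (h w).lintegral_le (hσ _) ht0 hA_meas hA_sub
  -- Finiteness permits cancelling `T * R μ` in `ℝ≥0∞`; it comes from domination by the zero
  -- measure.
  have hRfin : T * R μ ≠ ∞ := by
    refine ne_top_of_le_ne_top (ENNReal.mul_ne_top hC₀ hm_top) ?_
    rw [hR, ← hσm', Finset.mul_sum, Finset.mul_sum]
    refine Finset.sum_le_sum fun w _ => ?_
    simpa using (h₀ w).lintegral_le (hσ (v * w)) ht0 hA_meas hA_sub
  have hmain : T * (ρ u {a} * μ w₀ B) ≤ T * (ρ u {a} * ν w₀ B) + C * m := by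
    refine (ENNReal.add_le_add_iff_right hRfin).1 ?_
    rw [hsys, add_assoc, add_comm (C * m)]
    gcongr
  have hTp : ∀ b : ℝ≥0∞, T * (ρ u {a} * b) = p * (ENNReal.ofReal (s ^ α) * b) := by
    intro b
    rw [hT, ht, Real.mul_rpow haj.le hs.le, ENNReal.ofReal_mul (by positivity), ← hp]
    ring
  rw [hTp, hTp] at hmain
  have hpm : C * m = p * (C * (m / p)) := by
    rw [mul_left_comm, ENNReal.mul_div_cancel hp0 hp_top]
  rw [hpm, ← mul_add] at hmain
  exact (ENNReal.mul_le_mul_iff_right hp0 hp_top).1 hmain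

theorem TailDominated.le_of_zero {d : ℕ} {j : Fin d} {α : ℝ} {μ ν : Measure (Fin d → ℝ)}
    (h : TailDominated j α 0 μ ν) {s : ℝ} (hs : 0 < s) :
    μ.restrict {x | s < x j} ≤ ν.restrict {x | s < x j} := by
  refine Measure.le_iff.2 fun B hB => ?_
  have hset : MeasurableSet {x : Fin d → ℝ | s < x j} :=
    measurableSet_lt measurable_const (measurable_pi_apply j)
  rw [Measure.restrict_apply hB, Measure.restrict_apply hB]
  have := h s hs _ (hB.inter hset) Set.inter_subset_right
  rw [add_zero] at this
  exact (ENNReal.mul_le_mul_iff_right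
    (ENNReal.ofReal_pos.2 (Real.rpow_pos_of_pos hs α)).ne' ENNReal.ofReal_ne_top).1 this

theorem TailDominated.zero_of_tendsto {d : ℕ} {j : Fin d} {α : ℝ} {μ ν : Measure (Fin d → ℝ)}
    {C : ℕ → ℝ≥0∞} (hC : Filter.Tendsto C Filter.atTop (nhds 0))
    (h : ∀ n, TailDominated j α (C n) μ ν) : TailDominated j α 0 μ ν := by
  intro s hs B hB hBs
  exact ge_of_tendsto' (hC.const_add _) fun n => h n s hs B hB hBs

theorem corollaryc
    (d : ℕ) (α : Fin d → ℝ) (hα : ∀ j, 0 < α j)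
    -- the measures `ρ_v` on `(0, ∞)^d` and `ν_v^(i)` on `[0, ∞)^d`, seen as measures on `ℝ^d`
    (ρ : SignGroup d → Measure (Fin d → ℝ))
    (hρ_sf : ∀ v, SigmaFinite (ρ v))
    (hρ_on : ∀ v, ρ v (openOrthant d)ᶜ = 0)
    (ν : Fin 2 → SignGroup d → Measure (Fin d → ℝ))
    (hν_sf : ∀ i v, SigmaFinite (ν i v))
    (hν_on : ∀ i v, ν i v (closedOrthant d)ᶜ = 0)
    (K : Finset (Fin d)) (hK : K.Nonempty)
    (hν_K : ∀ i v, ν i v {x | ∀ k ∈ K, x k = 0} = 0)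
    (hρ_moment : ∀ v, ∀ j ∈ K,
      ∫⁻ x in openOrthant d, ENNReal.ofReal (x j ^ α j) ∂(ρ v) < ∞)
    (hν_tail : ∀ i v, ∀ j ∈ K,
      (⨆ (s : ℝ) (_ : 0 < s), ENNReal.ofReal (s ^ α j) * ν i v {x | s < x j}) < ∞)
    (h_system : ∀ v : SignGroup d,
      ∑ w, mulConvolution (ν 0 w) (ρ (v * w)) = ∑ w, mulConvolution (ν 1 w) (ρ (v * w)))
    (h_atom : ∀ j ∈ K, ∃ (u : SignGroup d) (a : Fin d → ℝ),
      a ∈ openOrthant d ∧ 0 < ρ u {a} ∧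
      (∫⁻ x in openOrthant d \ {a}, ENNReal.ofReal (x j ^ α j) ∂(ρ u))
          + ∑ v ∈ Finset.univ.erase u,
              ∫⁻ x in openOrthant d, ENNReal.ofReal (x j ^ α j) ∂(ρ v)
        < ρ u {a} * ENNReal.ofReal (a j ^ α j)) :
    ∀ v, ν 0 v = ν 1 v := by
  have hρ_ae : ∀ v, ∀ᵐ x ∂(ρ v), x ∈ openOrthant d := fun v => hρ_on v
  have hρ_res : ∀ v, (ρ v).restrict (openOrthant d) = ρ v := fun v =>
    Measure.restrict_eq_self_of_ae_mem (hρ_ae v)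
  have h_eval : ∀ v : SignGroup d, ∀ B : Set (Fin d → ℝ), MeasurableSet B →
      ∑ w, ∫⁻ x, ν 0 w (diagMap x ⁻¹' B) ∂(ρ (v * w)) =
        ∑ w, ∫⁻ x, ν 1 w (diagMap x ⁻¹' B) ∂(ρ (v * w)) := by
    intro v B hB
    have := congrArg (fun μ : Measure (Fin d → ℝ) => μ B) (h_system v)
    simpa only [Measure.finsetSum_apply, mulConvolution_apply _ _ hB] using this
  have h_tail_eq : ∀ j ∈ K, ∀ s : ℝ, 0 < s → ∀ v,
      (ν 0 v).restrict {x | s < x j} = (ν 1 v).restrict {x | s < x j} := by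
    intro j hj s hs v
    obtain ⟨u, a, ha, -, hlt⟩ := h_atom j hj
    have hcompl : (ρ u).restrict (openOrthant d \ {a}) = (ρ u).restrict {a}ᶜ := by
      refine Measure.restrict_congr_set ?_
      filter_upwards [hρ_ae u] with x hx
      exact propext ⟨fun hh => hh.2, fun hh => ⟨hx, hh⟩⟩
    simp only [hcompl, hρ_res] at hlt
    have hp_top : ρ u {a} * ENNReal.ofReal (a j ^ α j) ≠ ∞ := by
      refine ne_top_of_le_ne_top (hρ_moment u j hj).ne ?_
      rw [hρ_res, mul_comm, ← lintegral_singleton (fun x => ENNReal.ofReal (x j ^ α j)) a]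
      exact setLIntegral_le_lintegral _ _
    obtain ⟨m, hm⟩ : ∃ m, ∫⁻ x in {a}ᶜ, ENNReal.ofReal (x j ^ α j) ∂(ρ u)
      + ∑ v ∈ Finset.univ.erase u, ∫⁻ x, ENNReal.ofReal (x j ^ α j) ∂(ρ v) = m := ⟨_, rfl⟩
    obtain ⟨p, hp⟩ : ∃ p, ρ u {a} * ENNReal.ofReal (a j ^ α j) = p := ⟨_, rfl⟩
    rw [hm, hp] at hlt
    rw [hp] at hp_top
    have hp0 : p ≠ 0 := (bot_le.trans_lt hlt).ne'
    have hq : m / p < 1 := (ENNReal.div_lt_iff (Or.inl hp0) (Or.inl hp_top)).2 (by simpa)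
    let S : Fin 2 → SignGroup d → ℝ≥0∞ := fun i w =>
      ⨆ (s : ℝ) (_ : 0 < s), ENNReal.ofReal (s ^ α j) * ν i w {x | s < x j}
    let C₀ : ℝ≥0∞ := ∑ i, ∑ w, S i w
    have hC₀ : C₀ ≠ ∞ :=
      ENNReal.sum_ne_top.2 fun i _ => ENNReal.sum_ne_top.2 fun w _ => (hν_tail i w j hj).ne
    have hS : ∀ i w, S i w ≤ C₀ := fun i w =>
      (Finset.single_le_sum (fun _ _ => zero_le) (Finset.mem_univ w)).trans
        (Finset.single_le_sum (f := fun i => ∑ w, S i w) (fun _ _ => zero_le)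
          (Finset.mem_univ i))
    have h_dom : ∀ i w (κ : Measure (Fin d → ℝ)), TailDominated j (α j) C₀ (ν i w) κ :=
      fun i w κ => (TailDominated.of_tail (ν i w) κ).mono (hS i w)
    -- Both directions go together: each improved bound uses the previous bound in the opposite
    -- direction.
    have h_iter : ∀ n : ℕ, ∀ w, TailDominated j (α j) (C₀ * (m / p) ^ n) (ν 0 w) (ν 1 w) ∧
        TailDominated j (α j) (C₀ * (m / p) ^ n) (ν 1 w) (ν 0 w) := by
      intro n
      induction n with
      | zero => exact fun w => by simpa using ⟨h_dom 0 w (ν 1 w), h_dom 1 w (ν 0 w)⟩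
      | succ n ih =>
        intro w
        rw [pow_succ, ← mul_assoc]
        exact ⟨TailDominated.of_system hρ_ae h_eval ha hm hlt.ne_top hp hp0 hp_top hC₀
            (fun w => h_dom 0 w 0) (fun w => (ih w).2) w,
          TailDominated.of_system hρ_ae (fun v B hB => (h_eval v B hB).symm) ha hm hlt.ne_top
            hp hp0 hp_top hC₀ (fun w => h_dom 1 w 0) (fun w => (ih w).1) w⟩
    have h_lim : Filter.Tendsto (fun n : ℕ => C₀ * (m / p) ^ n) Filter.atTop (nhds 0) := by
      simpa using ENNReal.Tendsto.const_mul
        (ENNReal.tendsto_pow_atTop_nhds_zero_of_lt_one hq) (Or.inr hC₀)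
    exact le_antisymm
      ((TailDominated.zero_of_tendsto h_lim fun n => (h_iter n v).1).le_of_zero hs)
      ((TailDominated.zero_of_tendsto h_lim fun n => (h_iter n v).2).le_of_zero hs)
  intro v
  -- A countable cover, up to null sets: almost every point has some positive coordinate in `K`.
  let U : K × ℕ → Set (Fin d → ℝ) := fun q => {x | 1 / ((q.2 : ℝ) + 1) < x q.1}
  have hU : ∀ i, ∀ᵐ x ∂(ν i v), x ∈ ⋃ q, U q := by
    intro i
    have h1 : ∀ᵐ x ∂(ν i v), x ∈ closedOrthant d := hν_on i v
    have h2 : ∀ᵐ x ∂(ν i v), ¬ ∀ k ∈ K, x k = 0 := by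
      rw [ae_iff]
      simpa only [not_not] using hν_K i v
    filter_upwards [h1, h2] with x hx hxK
    push Not at hxK
    obtain ⟨k, hk, hne⟩ := hxK
    obtain ⟨n, hn⟩ := exists_nat_one_div_lt (lt_of_le_of_ne (hx k) hne.symm)
    exact Set.mem_iUnion.2 ⟨(⟨k, hk⟩, n), hn⟩
  rw [← Measure.restrict_eq_self_of_ae_mem (hU 0), ← Measure.restrict_eq_self_of_ae_mem (hU 1)]
  exact Measure.restrict_iUnion_congr.2 fun q =>
    h_tail_eq q.1 q.1.2 _ Nat.one_div_pos_of_nat v
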